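/- Let $c=2^{\omega}$, let $c^{+}$ be the successor cardinal of $c$, and let $C_\omega c^{+}$ be the set of ordinals $\alpha<c^{+}$ of cofinality at most $\omega$. There exists a family $\{A_y : y\in 3^{\omega}\}$ of mutually disjoint subsets of $C_\omega c^{+}$ each of which is stationary in $c^{+}$ (it meets every closed cofinal subset of $c^+$). Given any such family, put for $x\in 3^{\omega}$ $$B_x=\bigcup\{A_y : y\in 3^{\omega},\ y(n)\neq x(n)\text{ for all } n\in\omega\},$$ and let $$E=\{(x,f)\in 3^{\omega}\times (c^{+})^{\omega} : \sup_n f(n)\in B_x\}$$ carry the topology induced by the product topology, where $3=\{0,1,2\}$ and $c^{+}$ are discrete. Then $E$ is metrizable and $\tau$-Baire, $E\times E$ is a Baire space, $E\times E\times E$ is not a Baire space, and $E\times E$ is not $\tau$-Baire. Here a topological space $X$ is called $\tau$-Baire if in the following game on $X$ for every strategy of player $\beta'$ there exists a strategy of player $\alpha'$ which wins against it. The players choose non-empty open subsets of $X$ in the order $$V_1,\ V_1',\ W_1,\ W_1',\ V_2,\ V_2',\ W_2,\ W_2',\ \dots,$$ where $\beta'$ chooses the sets $V_k$ and $W_k$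 and $\alpha'$ chooses the sets $V_k'$ and $W_k'$, subject to $V_k\supset V_k'\supset V_{k+1}$ and $W_k\supset W_k'\supset W_{k+1}$ for all $k\geq 1$. A strategy may use all previous moves of both players on both boards. Player $\alpha'$ wins if both $\bigcap_{k} V_k\neq\emptyset$ and $\bigcap_{k} W_k\neq\emptyset$; otherwise $\beta'$ wins. -/

import Mathlib

/-! ## The tandem Banach-Mazur game -/

namespace TandemGame

/-- A move in a Banach-Mazur type game on `X`: a non-empty open subset of `X`. -/
abbrev Move (X : Type*) [TopologicalSpace X] : Type _ :=
  {U : TopologicalSpace.Opens X // (U : Set X).Nonempty}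

/- The moves of a play are numbered in chronological order `0, 1, 2, …`: for every `k`,
move `4k` is `V_{k+1}` (player `β'`), move `4k+1` is `V'_{k+1}` (player `α'`),
move `4k+2` is `W_{k+1}` (player `β'`), move `4k+3` is `W'_{k+1}` (player `α'`).
A history of length `n` is a sequence `Fin n → Move X` of the moves `0, …, n-1`.
So `β'` moves after histories of even length and `α'` after histories of odd length. -/

/-- A strategy of player `β'`, with full information on the past of both boards. The opening
moves `V_1` and `W_1` (after histories of length `0` and `2`) are unrestricted; every later move,
after a history of length `2 * k + 4`, has to be contained in the last move of `α'` on the same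
board, that is in move number `2 * k + 1`. The values on histories of odd length are irrelevant. -/
structure BetaStrategy (X : Type*) [TopologicalSpace X] where
  move : (n : ℕ) → (Fin n → Move X) → Move X
  legal : ∀ (k : ℕ) (h : Fin (2 * k + 4) → Move X), move (2 * k + 4) h ≤ h ⟨2 * k + 1, by omega⟩

/-- A strategy of player `α'`, with full information on the past of both boards: the answer has
to be contained in the move that `β'` has just made. The values on histories of even length are
irrelevant. -/
structure AlphaStrategy (X : Type*) [TopologicalSpace X] where
  move : (n : ℕ) → (Fin n → Move X) → Move X
  legal : ∀ (k : ℕ) (h : Fin (2 * k + 1) → Move X), move (2 * k + 1) h ≤ h (Fin.last (2 * k))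

variable {X : Type*} [TopologicalSpace X]

/-- The play of the strategy `a` of player `α'` against the strategy `b` of player `β'`. -/
def play (a : AlphaStrategy X) (b : BetaStrategy X) (n : ℕ) : Move X :=
  if n % 2 = 0 then b.move n (fun i : Fin n => play a b i)
  else a.move n (fun i : Fin n => play a b i)
termination_by n
decreasing_by all_goals exact i.2

/-- The strategy `a` of player `α'` wins against the strategy `b` of player `β'`: on both boards
the sets chosen in the play of `a` against `b` have a common point. -/
def Beats (a : AlphaStrategy X) (b : BetaStrategy X) : Prop :=
  (⋂ k : ℕ, ((play a b (4 * k)).1 : Set X)).Nonempty ∧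
    (⋂ k : ℕ, ((play a b (4 * k + 2)).1 : Set X)).Nonempty

end TandemGame

/-- `X` is a `τ`-Baire space: every strategy of player `β'` in the tandem Banach-Mazur game on `X`
is beaten by some strategy of player `α'`. -/
def IsTauBaire (X : Type*) [TopologicalSpace X] : Prop :=
  ∀ b : TandemGame.BetaStrategy X, ∃ a : TandemGame.AlphaStrategy X, TandemGame.Beats a b

/-! ## The space `E` -/

/-- The cardinal `c⁺`, the successor of the cardinality `c` of the continuum, as the well-ordered
set of all ordinals below it. -/
abbrev CPlus : Type := (Order.succ Cardinal.continuum.{0}).ord.ToType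

/-- The set `c⁺` carries the discrete topology. -/
instance CPlus.instTopologicalSpace : TopologicalSpace CPlus := ⊥

instance CPlus.instDiscreteTopology : DiscreteTopology CPlus := ⟨rfl⟩

/-- `C_ω c⁺`, the set of all ordinals `α < c⁺` of cofinality at most `ω`. -/
def COmega : Set CPlus := {α | Order.cof (Set.Iio α) ≤ Cardinal.aleph0}

/-- `{A_y : y ∈ 3^ω}` is a family of mutually disjoint stationary subsets of `C_ω c⁺`. -/
structure IsDisjointStationaryFamily (A : (ℕ → Fin 3) → Set CPlus) : Prop where
  subset : ∀ y, A y ⊆ COmega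
  stationary : ∀ y, IsStationary (A y)
  disjoint : ∀ y z, y ≠ z → Disjoint (A y) (A z)

/-- `B_x` is the union of all `A_y` such that `y(n) ≠ x(n)` for all `n`. -/
def unionAvoiding (A : (ℕ → Fin 3) → Set CPlus) (x : ℕ → Fin 3) : Set CPlus :=
  {γ | ∃ y : ℕ → Fin 3, (∀ n, y n ≠ x n) ∧ γ ∈ A y}

/-- The space `E` of all `(x, f) ∈ 3^ω × (c⁺)^ω` with `sup f ∈ B_x`, with the topology induced by
the product topology, `3` and `c⁺` being discrete. -/
abbrev SpaceE (A : (ℕ → Fin 3) → Set CPlus) : Type :=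
  {p : (ℕ → Fin 3) × (ℕ → CPlus) // ∃ γ ∈ unionAvoiding A p.1, IsLUB (Set.range p.2) γ}

open Cardinal Order Set Topology Filter TandemGame

/-! ### Club and stationary subsets of c⁺ -/

namespace CPlus

/-! A point of E is a branch x with a sequence of ordinals whose supremum lies in some A_y, where y
differs from x everywhere. At each coordinate two branches leave one of the three values free, while
three branches may leave none. This separates the square from the cube.

For `SpaceE.isTauBaire`, fix a strategy of β' and let α' push the ordinals past the terms of a
sequence d in c⁺. The resulting pair of limit branches takes at most 2^ω < c⁺ values, so some pair r
cannot be avoided by prescribing lower bounds for d (`exists_not_canAvoid_nil`). Closing off under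
the operations involved gives a club whose points γ of countable cofinality are the supremum on both
boards of a play with branches r (`exists_fibre_club`). Taking y different everywhere from both
branches and γ ∈ A_y in this club puts both limit points in E.

In the cube, generic triples have equal suprema γ. If the branches start with 0, 1, 2, then the y
with γ ∈ A_y has no admissible value at 0. If E × E were τ-Baire, then E⁴ and hence E³ would be
Baire. -/

theorem cof_eq : Order.cof CPlus = Order.succ 𝔠 := by
  rw [Ordinal.cof_toType, (isRegular_succ aleph0_le_continuum).cof_ord]

theorem cof_ne_aleph0 : Order.cof CPlus ≠ ℵ₀ := by
  rw [cof_eq]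
  exact (aleph0_le_continuum.trans_lt (lt_succ _)).ne'

instance : NoMaxOrder CPlus :=
  Cardinal.noMaxOrder (aleph0_le_continuum.trans (le_succ _))

instance : Nonempty CPlus := by
  rw [← cof_ne_zero_iff, cof_eq]
  exact (succ_pos _).ne'

theorem mk_Iio_le (a : CPlus) : #(Iio a) ≤ 𝔠 :=
  lt_succ_iff.1 ((mk_Iio_lt a (by simp)).trans_eq (mk_ord_toType _))

/-- Families of at most continuum many elements of `c⁺` are strictly bounded. -/
theorem exists_forall_lt {ι : Type} (hι : #ι ≤ 𝔠) (f : ι → CPlus) : ∃ b, ∀ i, f i < b := by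
  have h : ¬ IsCofinal (range f) := fun h ↦
    (cof_le h).not_gt (mk_range_le.trans_lt (by rw [cof_eq]; exact lt_succ_iff.2 hι))
  obtain ⟨b, hb⟩ := not_isCofinal_iff.1 h
  exact ⟨b, fun i ↦ hb _ ⟨i, rfl⟩⟩

theorem exists_isLUB_range {ι : Type} (hι : #ι ≤ 𝔠) (f : ι → CPlus) :
    ∃ γ, IsLUB (range f) γ := by
  obtain ⟨b, hb⟩ := exists_forall_lt hι f
  have hne : (upperBounds (range f)).Nonempty := ⟨b, by rintro _ ⟨i, rfl⟩; exact (hb i).le⟩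
  refine ⟨WellFounded.min wellFounded_lt _ hne, WellFounded.min_mem _ _ hne, fun u hu ↦ ?_⟩
  exact not_lt.1 (WellFounded.not_lt_min wellFounded_lt _ hu)

theorem exists_lt_of_forall_mem_list {d : Set CPlus} (hd : d.Nonempty) (s : List CPlus)
    (h : ∀ a ∈ s, ∃ t ∈ d, a < t) : ∃ t ∈ d, ∀ a ∈ s, a < t := by
  induction s with
  | nil => exact hd.imp fun t ht ↦ ⟨ht, by simp⟩
  | cons a s ih =>
    obtain ⟨t, ht, hs⟩ := ih fun b hb ↦ h b (List.mem_cons_of_mem _ hb)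
    obtain ⟨u, hu, ha⟩ := h a List.mem_cons_self
    refine ⟨max t u, by rcases max_choice t u with h | h <;> rwa [h], fun b hb ↦ ?_⟩
    rcases List.mem_cons.1 hb with rfl | hb
    · exact lt_max_of_lt_right ha
    · exact lt_max_of_lt_left (hs b hb)

/-- The points closed under an operation on finite sequences form a club set. -/
theorem isClub_closurePoints (H : List CPlus → CPlus) :
    IsClub {γ | ∀ s : List CPlus, (∀ a ∈ s, a < γ) → H s < γ} := by
  constructor
  · intro d hd hne _ γ hγ s hs
    obtain ⟨t, ht, hst⟩ := exists_lt_of_forall_mem_list hne s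
      fun a ha ↦ (lt_isLUB_iff hγ).1 (hs a ha)
    exact (hd ht s hst).trans_le (hγ.1 ht)
  · intro a
    have step : ∀ β : CPlus, ∃ b, β < b ∧ ∀ s : List CPlus, (∀ a ∈ s, a < β) → H s < b := by
      intro β
      have hcard : #(List (Iio β)) ≤ 𝔠 :=
        (mk_list_le_max _).trans (max_le aleph0_le_continuum (mk_Iio_le β))
      obtain ⟨b, hb⟩ := exists_forall_lt hcard fun s ↦ H (s.map Subtype.val)
      refine ⟨max b (succ β), lt_max_of_lt_right (lt_succ β), fun s hs ↦ lt_max_of_lt_left ?_⟩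
      lift s to List (Iio β) using hs
      exact hb s
    choose g hg hH using step
    obtain ⟨γ, hγ⟩ := exists_isLUB_range (ι := ℕ) (by simpa using aleph0_le_continuum)
      fun n ↦ g^[n] a
    refine ⟨γ, fun s hs ↦ ?_, hγ.1 ⟨0, rfl⟩⟩
    obtain ⟨_, ⟨n, rfl⟩, hn⟩ := exists_lt_of_forall_mem_list (range_nonempty _) s
      fun a ha ↦ (lt_isLUB_iff hγ).1 (hs a ha)
    refine (hH _ s hn).trans_le (hγ.1 ⟨n + 1, ?_⟩)
    exact Function.iterate_succ_apply' g n a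

theorem isClub_Ioi (a : CPlus) : IsClub (Ioi a) := by
  constructor
  · rintro d hd ⟨t, ht⟩ _ γ hγ
    exact (hd ht).trans_le (hγ.1 ht)
  · intro b
    exact ⟨succ (max a b), (le_max_left a b).trans_lt (lt_succ _),
      (le_max_right a b).trans (le_succ _)⟩

theorem isStationary_COmega : IsStationary COmega := by
  intro t ht
  have step : ∀ a : CPlus, ∃ b ∈ t, a < b := fun a ↦ by
    obtain ⟨b, hb, hab⟩ := ht.isCofinal (succ a)
    exact ⟨b, hb, (lt_succ a).trans_le hab⟩
  choose g hgt hg using step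
  obtain ⟨a⟩ : Nonempty CPlus := inferInstance
  obtain ⟨γ, hγ⟩ := exists_isLUB_range (ι := ℕ) (by simpa using aleph0_le_continuum)
    fun n ↦ g^[n + 1] a
  have hlt : ∀ n, g^[n + 1] a < γ := fun n ↦
    ((hg _).trans_eq (Function.iterate_succ_apply' g (n + 1) a).symm).trans_le
      (hγ.1 ⟨n + 1, rfl⟩)
  refine ⟨γ, ?_, ht.isLUB_mem ?_ (range_nonempty _) hγ⟩
  · refine (cof_le (s := range fun n ↦ (⟨g^[n + 1] a, hlt n⟩ : Iio γ)) fun b ↦ ?_).trans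
      (mk_range_le.trans (by simp))
    obtain ⟨_, ⟨n, rfl⟩, hn⟩ := (lt_isLUB_iff hγ).1 b.2
    exact ⟨_, ⟨n, rfl⟩, hn.le⟩
  · rintro _ ⟨n, rfl⟩
    simp only [Function.iterate_succ_apply']
    exact hgt _

theorem mk_branches : #(ℕ → Fin 3) = 𝔠 := by
  simpa using nat_power_aleph0 (n := 3) (by norm_num)

/-- Ulam's matrix argument: `C_ω c⁺` contains continuum many disjoint stationary sets. -/
theorem exists_isDisjointStationaryFamily :
    ∃ A : (ℕ → Fin 3) → Set CPlus, IsDisjointStationaryFamily A := by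
  have hemb : ∀ α : CPlus, Nonempty (Iio α ↪ (ℕ → Fin 3)) := fun α ↦ by
    rw [← Cardinal.le_def, mk_branches]
    exact mk_Iio_le α
  have g : ∀ α : CPlus, Iio α ↪ (ℕ → Fin 3) := fun α ↦ (hemb α).some
  -- The Ulam matrix: row β covers the part of C_ω above β by 2^ω entries, so one of them is
  -- stationary. Entries in the same column are disjoint because each `g α` is injective.
  let S (β : CPlus) (ξ : ℕ → Fin 3) : Set CPlus :=
    {α | α ∈ COmega ∧ ∃ h : β < α, g α ⟨β, h⟩ = ξ}
  have hS : ∀ β, ∃ ξ, IsStationary (S β ξ) := by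
    intro β
    refine (isStationary_iUnion_iff cof_ne_aleph0 (f := S β) ?_).1 ?_
    · rw [lift_id, lift_id, mk_branches, cof_eq]
      exact lt_succ _
    · intro t ht
      obtain ⟨α, hα, hαt, hβ⟩ := isStationary_COmega (ht.inter cof_ne_aleph0 (isClub_Ioi β))
      exact ⟨α, mem_iUnion.2 ⟨_, hα, hβ, rfl⟩, hαt⟩
  choose ξ hξ using hS
  -- There are c⁺ rows but only c columns, so one column has stationary entries in more than c rows.
  obtain ⟨ξ₀, h₀⟩ := infinite_pigeonhole_card_lt ξ
    (by rw [mk_branches, mk_ord_toType]; exact lt_succ _)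
    (by rw [mk_ord_toType]; exact aleph0_le_continuum.trans (le_succ _))
  obtain ⟨e⟩ := Cardinal.le_def _ _ |>.1 h₀.le
  refine ⟨fun y ↦ S (e y) ξ₀, fun y α hα ↦ hα.1, fun y ↦ ?_, fun y z hyz ↦ ?_⟩
  · have := hξ (e y)
    rwa [show ξ (e y) = ξ₀ from (e y).2] at this
  · rw [Set.disjoint_left]
    rintro α ⟨-, hy, hy'⟩ ⟨-, hz, hz'⟩
    have := (g α).injective (hy'.trans hz'.symm)
    exact hyz (e.injective (Subtype.ext (Subtype.mk.inj this)))

end CPlus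

/-! ### Unavoidable values of functions of ordinal sequences -/

namespace CPlus

/-- The first `n` terms of a sequence. -/
def initial (d : ℕ → CPlus) (n : ℕ) : List CPlus := (List.range n).map d

@[simp] theorem length_initial (d : ℕ → CPlus) (n : ℕ) : (initial d n).length = n := by
  simp [initial]

theorem initial_succ (d : ℕ → CPlus) (n : ℕ) : initial d (n + 1) = initial d n ++ [d n] := by
  simp [initial, List.range_succ]

theorem initial_getD (d : ℕ → CPlus) {n i : ℕ} (h : i < n) (a : CPlus) :
    (initial d n).getD i a = d i := by
  simp [initial, h]

theorem eq_of_initial_eq {d d' : ℕ → CPlus} {n : ℕ} (h : initial d n = initial d' n) {i : ℕ}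
    (hi : i < n) : d i = d' i := by
  rw [← initial_getD d hi (d 0), h, initial_getD d' hi]

theorem exists_seq_of_initial (g : List CPlus → CPlus) :
    ∃ d : ℕ → CPlus, ∀ n, d n = g (initial d n) := by
  let l : ℕ → List CPlus := fun n ↦ Nat.rec [] (fun _ s ↦ s ++ [g s]) n
  have h : ∀ n, initial (fun n ↦ g (l n)) n = l n := by
    intro n
    induction n with
    | zero => rfl
    | succ n ih => rw [initial_succ, ih]
  exact ⟨fun n ↦ g (l n), fun n ↦ by rw [h]⟩

/-- After the initial part `s` of a sequence of ordinals, the player who names lower bounds for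
the coming terms has a strategy that keeps the value of `Φ` away from `r`. -/
def CanAvoid {R : Type} (Φ : (ℕ → CPlus) → R) (r : R) (s : List CPlus) : Prop :=
  ∃ σ : List CPlus → CPlus, ∀ d : ℕ → CPlus, initial d s.length = s →
    (∀ n, s.length ≤ n → σ (initial d n) ≤ d n) → Φ d ≠ r

variable {R : Type} {Φ : (ℕ → CPlus) → R}

/-- A sequence that dominates all the avoiding strategies at once would have to avoid its own value.
-/
theorem exists_not_canAvoid_nil (hR : #R ≤ 𝔠) (Φ : (ℕ → CPlus) → R) :
    ∃ r, ¬ CanAvoid Φ r [] := by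
  by_contra! h
  choose σ hσ using h
  choose τ hτ using fun s ↦ exists_forall_lt hR fun r ↦ σ r s
  obtain ⟨d, hd⟩ := exists_seq_of_initial τ
  exact hσ (Φ d) d rfl (fun n _ ↦ (hd n).symm ▸ (hτ _ _).le) rfl

theorem exists_not_canAvoid_append {r : R} {s : List CPlus} (h : ¬ CanAvoid Φ r s) (ε : CPlus) :
    ∃ a, ε ≤ a ∧ ¬ CanAvoid Φ r (s ++ [a]) := by
  contrapose! h
  have h' : ∀ a, ∃ σ : List CPlus → CPlus, ε ≤ a → ∀ d : ℕ → CPlus,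
      initial d (s ++ [a]).length = s ++ [a] →
      (∀ n, (s ++ [a]).length ≤ n → σ (initial d n) ≤ d n) → Φ d ≠ r := fun a ↦ by
    by_cases ha : ε ≤ a
    · exact (h a ha).imp fun σ hσ _ ↦ hσ
    · exact ⟨fun _ ↦ ε, fun h ↦ absurd h ha⟩
  choose σ hσ using h'
  -- Name ε first, then read the reply a at position `s.length` and follow the strategy for `s ++
  -- [a]`.
  refine ⟨fun t ↦ if t.length ≤ s.length then ε else σ (t.getD s.length ε) t,
    fun d hd hσd ↦ hσ (d s.length) ?_ d ?_ fun n hn ↦ ?_⟩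
  · simpa using hσd s.length le_rfl
  · rw [List.length_append, List.length_singleton, initial_succ, hd]
  · rw [List.length_append, List.length_singleton] at hn
    have := hσd n (by lia)
    simp only [length_initial] at this
    rwa [if_neg (by lia), initial_getD d hn] at this

theorem exists_eq_of_not_canAvoid {r : R} {s : List CPlus} (h : ¬ CanAvoid Φ r s) :
    ∃ d, initial d s.length = s ∧ Φ d = r := by
  by_contra! h'
  obtain ⟨a⟩ : Nonempty CPlus := inferInstance
  exact h ⟨fun _ ↦ a, fun d hd _ ↦ h' d hd⟩

theorem exists_seq_of_mem_COmega {γ a : CPlus} (hγ : γ ∈ COmega) (ha : a < γ) :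
    ∃ e : ℕ → CPlus, (∀ n, e n < γ) ∧ ∀ ε < γ, ∃ n, ε ≤ e n := by
  obtain ⟨s, hs, hcard⟩ := exists_cof_eq (Iio γ)
  have hc : s.Countable := by
    rw [← le_aleph0_iff_set_countable, hcard]
    exact hγ
  obtain ⟨b, hb, -⟩ := hs ⟨a, ha⟩
  obtain ⟨e, rfl⟩ := hc.exists_eq_range ⟨b, hb⟩
  refine ⟨fun n ↦ e n, fun n ↦ (e n).2, fun ε hε ↦ ?_⟩
  obtain ⟨_, ⟨n, rfl⟩, hn⟩ := hs ⟨ε, hε⟩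
  exact ⟨n, hn⟩

/-- Suppose that a function `Φ` with at most continuum many values has closed fibres. Then, for
some value `r` and all `γ` of countable cofinality in some club set, there are sequences in the
fibre over `r` which converge to `γ`, and for which given finitely determined ordinals are
below `γ`. -/
theorem exists_fibre_club {ι : Type} [Countable ι] (hR : #R ≤ 𝔠) (Φ : (ℕ → CPlus) → R)
    (hΦ : ∀ d r, (∀ n, ∃ d', (∀ i < n, d' i = d i) ∧ Φ d' = r) → Φ d = r)
    (F : (ℕ → CPlus) → ι → CPlus)
    (hF : ∀ j, ∃ n, ∀ d d', (∀ i < n, d i = d' i) → F d j = F d' j) :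
    ∃ r, ∃ C : Set CPlus, IsClub C ∧ ∀ γ ∈ C, γ ∈ COmega →
      ∃ d, Φ d = r ∧ (∀ j, F d j < γ) ∧ ∀ ε < γ, ∀ i < 2, ∃ n, ε ≤ d (2 * n + i) := by
  obtain ⟨r, hr⟩ := exists_not_canAvoid_nil hR Φ
  have hstep : ∀ s ε, ∃ a, ε ≤ a ∧ (¬ CanAvoid Φ r s → ¬ CanAvoid Φ r (s ++ [a])) := by
    intro s ε
    by_cases h : CanAvoid Φ r s
    · exact ⟨ε, le_rfl, fun h' ↦ absurd h h'⟩
    · obtain ⟨a, ha, ha'⟩ := exists_not_canAvoid_append h ε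
      exact ⟨a, ha, fun _ ↦ ha'⟩
  choose next hnext hgood using hstep
  obtain ⟨o⟩ : Nonempty CPlus := inferInstance
  choose bound hbound using fun s : List CPlus ↦ exists_forall_lt
    ((mk_le_aleph0 (α := ι)).trans aleph0_le_continuum) (F fun i ↦ s.getD i o)
  -- One operation encodes both `bound` and `next`, the head of the list serving as the argument ε
  -- of `next`.
  let H : List CPlus → CPlus := fun s ↦
    max (bound s) (match s with | [] => o | ε :: s => next s ε)
  refine ⟨r, _, isClub_closurePoints H, fun γ hC hγ ↦ ?_⟩
  have hb : ∀ s : List CPlus, (∀ a ∈ s, a < γ) → bound s < γ := fun s hs ↦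
    (le_max_left _ _).trans_lt (hC s hs)
  have hn : ∀ ε < γ, ∀ s : List CPlus, (∀ a ∈ s, a < γ) → next s ε < γ := fun ε hε s hs ↦
    (le_max_right (bound (ε :: s)) _).trans_lt
      (hC (ε :: s) (List.forall_mem_cons.2 ⟨hε, hs⟩))
  obtain ⟨e, heγ, he⟩ := exists_seq_of_mem_COmega hγ (hb [] (by simp))
  -- Halving the index uses every `e n` twice, at 2n and 2n + 1, so that the terms of either parity
  -- are cofinal in γ.
  obtain ⟨d, hd⟩ := exists_seq_of_initial fun s ↦ next s (e (s.length / 2))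
  simp only [length_initial] at hd
  have key : ∀ n, (∀ a ∈ initial d n, a < γ) ∧ ¬ CanAvoid Φ r (initial d n) := by
    intro n
    induction n with
    | zero => exact ⟨by simp [initial], hr⟩
    | succ n ih =>
      rw [initial_succ, hd n]
      refine ⟨fun a ha ↦ ?_, hgood _ _ ih.2⟩
      rcases List.mem_append.1 ha with ha | ha
      · exact ih.1 a ha
      · rw [List.mem_singleton.1 ha]
        exact hn _ (heγ _) _ ih.1
  refine ⟨d, hΦ d r fun n ↦ ?_, fun j ↦ ?_, fun ε hε i hi ↦ ?_⟩
  · obtain ⟨d', hd', h⟩ := exists_eq_of_not_canAvoid (key n).2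
    rw [length_initial] at hd'
    exact ⟨d', fun i hi ↦ eq_of_initial_eq hd' hi, h⟩
  · obtain ⟨n, hn⟩ := hF j
    rw [hn d (fun i ↦ (initial d n).getD i o) fun i hi ↦ (initial_getD d hi o).symm]
    exact (hbound _ j).trans (hb _ (key n).1)
  · obtain ⟨n, hn⟩ := he ε hε
    refine ⟨n, hn.trans ?_⟩
    rw [hd, show (2 * n + i) / 2 = n by lia]
    exact hnext _ _

end CPlus

/-! ### Plays of the tandem game and Baire squares -/

namespace TandemGame

variable {X : Type*} [TopologicalSpace X]

theorem play_of_even (a : AlphaStrategy X) (b : BetaStrategy X) {n : ℕ} (hn : n % 2 = 0) :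
    play a b n = b.move n fun i : Fin n ↦ play a b i := by
  rw [play, if_pos hn]

theorem play_of_odd (a : AlphaStrategy X) (b : BetaStrategy X) {n : ℕ} (hn : n % 2 = 1) :
    play a b n = a.move n fun i : Fin n ↦ play a b i := by
  rw [play, if_neg (by lia)]

theorem play_beta_le (a : AlphaStrategy X) (b : BetaStrategy X) (k : ℕ) :
    play a b (2 * k + 4) ≤ play a b (2 * k + 1) := by
  rw [play_of_even a b (n := 2 * k + 4) (by lia)]
  exact b.legal k _

theorem play_alpha_le (a : AlphaStrategy X) (b : BetaStrategy X) (k : ℕ) :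
    play a b (2 * k + 1) ≤ play a b (2 * k) := by
  rw [play_of_odd a b (n := 2 * k + 1) (by lia)]
  exact a.legal k _

end TandemGame

/-- The square of a `τ`-Baire space is a Baire space. -/
theorem IsTauBaire.baireSpace_prod {X : Type*} [TopologicalSpace X] (h : IsTauBaire X) :
    BaireSpace (X × X) := by
  refine ⟨fun f ho hd ↦ dense_iff_inter_open.2 fun O hO ⟨⟨p₀, q₀⟩, hpq⟩ ↦ ?_⟩
  have hbox : ∀ (O : Set (X × X)), IsOpen O → ∀ p q, (p, q) ∈ O →
      ∃ P Q : Move X, p ∈ P.1 ∧ q ∈ Q.1 ∧ ∀ x ∈ P.1, ∀ y ∈ Q.1, (x, y) ∈ O := by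
    intro O hO p q hpq
    obtain ⟨u, v, hu, hv, hpu, hqv, huv⟩ := isOpen_prod_iff.1 hO p q hpq
    exact ⟨⟨⟨u, hu⟩, p, hpu⟩, ⟨⟨v, hv⟩, q, hqv⟩, hpu, hqv, fun x hx y hy ↦ huv ⟨hx, hy⟩⟩
  have hstep : ∀ (k : ℕ) (P' Q' : Move X), ∃ P Q : Move X, P ≤ P' ∧ Q ≤ Q' ∧
      ∀ x ∈ P.1, ∀ y ∈ Q.1, (x, y) ∈ f k := by
    intro k P' Q'
    have hPQ : IsOpen ((P'.1 : Set X) ×ˢ (Q'.1 : Set X)) := P'.1.isOpen.prod Q'.1.isOpen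
    obtain ⟨⟨p, q⟩, h1, h2⟩ := (hd k).inter_open_nonempty _ hPQ (P'.2.prod Q'.2)
    obtain ⟨P, Q, hp, hq, h⟩ := hbox _ (hPQ.inter (ho k)) p q ⟨h1, h2⟩
    exact ⟨P, Q, fun x hx ↦ (h x hx q hq).1.1, fun y hy ↦ (h p hp y hy).1.2,
      fun x hx y hy ↦ (h x hx y hy).2⟩
  choose P Q hP hQ hPQ using hstep
  obtain ⟨U, V, -, -, hUV⟩ := hbox O hO p₀ q₀ hpq
  -- After opening with U and V, both moves of β' in a round are computed from the same pair of
  -- answers of the previous round, so their product lies in `f k`.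
  let b : BetaStrategy X :=
    { move n s :=
        if hn : n < 4 then if n = 0 then U else V
        else if n % 4 < 2 then
          P ((n - 4) / 4) (s ⟨4 * ((n - 4) / 4) + 1, by lia⟩) (s ⟨4 * ((n - 4) / 4) + 3, by lia⟩)
        else
          Q ((n - 4) / 4) (s ⟨4 * ((n - 4) / 4) + 1, by lia⟩) (s ⟨4 * ((n - 4) / 4) + 3, by lia⟩)
      legal k s := by
        rw [dif_neg (by lia)]
        split_ifs with hk
        · convert hP _ _ _ using 3
          lia
        · convert hQ _ _ _ using 3
          lia }
  obtain ⟨a, ⟨p, hp⟩, ⟨q, hq⟩⟩ := h b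
  simp only [mem_iInter, SetLike.mem_coe] at hp hq
  refine ⟨(p, q), hUV p ?_ q ?_, mem_iInter.2 fun k ↦ hPQ k (play a b (4 * k + 1))
    (play a b (4 * k + 3)) p ?_ q ?_⟩
  · have := hp 0
    rwa [play_of_even a b (by lia)] at this
  · have := hq 0
    rwa [play_of_even a b (by lia)] at this
  · have := hp (k + 1)
    rw [play_of_even a b (by lia)] at this
    simp only [b] at this
    rw [dif_neg (by lia), if_pos (by lia)] at this
    simpa only [show (4 * (k + 1) - 4) / 4 = k by lia] using this
  · have := hq (k + 1)
    rw [play_of_even a b (by lia)] at this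
    simp only [b] at this
    rw [dif_neg (by lia), if_neg (by lia)] at this
    simpa only [show (4 * (k + 1) + 2 - 4) / 4 = k by lia] using this

/-! ### Cylinders in E -/

namespace SpaceE

variable {A : (ℕ → Fin 3) → Set CPlus}

/-- The points of `E` with the same first `n` coordinates as `p`. -/
def cylinder (p : SpaceE A) (n : ℕ) : Set (SpaceE A) :=
  {q | ∀ i < n, q.1.1 i = p.1.1 i ∧ q.1.2 i = p.1.2 i}

theorem self_mem_cylinder (p : SpaceE A) (n : ℕ) : p ∈ cylinder p n := fun _ _ ↦ ⟨rfl, rfl⟩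

theorem continuous_branch (i : ℕ) : Continuous fun q : SpaceE A ↦ q.1.1 i := by fun_prop

theorem continuous_ordinal (i : ℕ) : Continuous fun q : SpaceE A ↦ q.1.2 i := by fun_prop

theorem isOpen_cylinder (p : SpaceE A) (n : ℕ) : IsOpen (cylinder p n) := by
  have : cylinder p n = ⋂ i ∈ Iio n, {q | q.1.1 i = p.1.1 i ∧ q.1.2 i = p.1.2 i} := by
    ext; simp [cylinder]
  rw [this]
  refine (finite_Iio n).isOpen_biInter fun i _ ↦ ?_
  exact ((isOpen_discrete {p.1.1 i}).preimage (continuous_branch i)).inter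
    ((isOpen_discrete {p.1.2 i}).preimage (continuous_ordinal i))

theorem exists_cylinder_subset {p : SpaceE A} {U : Set (SpaceE A)} (hU : U ∈ 𝓝 p) :
    ∃ n, cylinder p n ⊆ U := by
  by_contra! h
  simp only [not_subset] at h
  choose q hq hqU using h
  have hlim : Tendsto q atTop (𝓝 p) := by
    rw [tendsto_subtype_rng, Prod.tendsto_iff, tendsto_pi_nhds, tendsto_pi_nhds]
    constructor <;> intro i <;> refine tendsto_const_nhds.congr' ?_ <;>
      filter_upwards [eventually_gt_atTop i] with n hn
    · exact (hq n i hn).1.symm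
    · exact (hq n i hn).2.symm
  obtain ⟨n, hn⟩ := (hlim.eventually hU).exists
  exact hqU n hn

/-- Any finitely many coordinates extend to a point of `E`, with all the later ordinals
being equal and large. -/
theorem exists_extension (hA : ∀ y, IsStationary (A y)) (x : ℕ → Fin 3) (f : ℕ → CPlus) (n : ℕ)
    (ε : CPlus) :
    ∃ p : SpaceE A, p.1.1 = x ∧ (∀ i < n, p.1.2 i = f i) ∧ ∀ i, n ≤ i → ε < p.1.2 i := by
  obtain ⟨b, hb⟩ := CPlus.exists_forall_lt (ι := ℕ) (by simpa using aleph0_le_continuum) f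
  -- In `Fin 3`, x + 1 is a sequence differing from x at every coordinate.
  obtain ⟨γ, hγA, hγ⟩ := hA (fun n ↦ x n + 1) (CPlus.isClub_Ioi (max b ε))
  rw [mem_Ioi, max_lt_iff] at hγ
  refine ⟨⟨(x, fun i ↦ if i < n then f i else γ), γ, ⟨_, fun n ↦ ?_, hγA⟩, ?_, ?_⟩, rfl, ?_, ?_⟩
  · simp
  · rintro _ ⟨i, rfl⟩
    dsimp only
    split_ifs
    · exact ((hb i).trans hγ.1).le
    · exact le_rfl
  · exact fun u hu ↦ hu ⟨n, if_neg (lt_irrefl n)⟩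
  · exact fun i hi ↦ if_pos hi
  · intro i hi
    simpa only [if_neg hi.not_gt] using hγ.2

theorem exists_mem_ordinal_gt (hA : ∀ y, IsStationary (A y)) {p : SpaceE A} {U : Set (SpaceE A)}
    (hU : U ∈ 𝓝 p) (ε : CPlus) : ∃ q ∈ U, ∃ m, ε < q.1.2 m := by
  obtain ⟨n, hn⟩ := exists_cylinder_subset hU
  obtain ⟨q, hx, hf, hε⟩ := exists_extension hA p.1.1 p.1.2 n ε
  exact ⟨q, hn fun i hi ↦ ⟨congrFun hx i, hf i hi⟩, n, hε n le_rfl⟩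

/-- The cylinders as moves in the game. -/
def cylinderMove (p : SpaceE A) (n : ℕ) : Move (SpaceE A) :=
  ⟨⟨cylinder p n, isOpen_cylinder p n⟩, p, self_mem_cylinder p n⟩

theorem exists_cylinderMove_le (hA : ∀ y, IsStationary (A y)) (k : ℕ) (V : Move (SpaceE A))
    (ε : CPlus) :
    ∃ p n, cylinderMove p n ≤ V ∧ k ≤ n ∧ ∃ i < n, ε < p.1.2 i := by
  obtain ⟨p, hp⟩ := V.2
  obtain ⟨n, hn⟩ := exists_cylinder_subset (V.1.isOpen.mem_nhds hp)
  obtain ⟨q, hx, hf, hε⟩ := exists_extension hA p.1.1 p.1.2 n ε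
  have hq : q ∈ cylinder p n := fun i hi ↦ ⟨congrFun hx i, hf i hi⟩
  refine ⟨q, max (n + 1) k, fun r hr ↦ hn fun i hi ↦ ?_, le_max_right _ _, n, by simp, hε n le_rfl⟩
  have := hr i (lt_max_of_lt_left (hi.trans (Nat.lt_succ_self n)))
  exact ⟨this.1.trans (hq i hi).1, this.2.trans (hq i hi).2⟩

end SpaceE

/-! ### Strategies of α' driven by a sequence of parameters -/

namespace TandemGame

variable {X : Type*} [TopologicalSpace X]

/-- The strategy of `α'` which answers the move number `n` by means of the rule `r`, using in its
`k`-th move the parameter `d k`. -/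
def followSeq {P : Type*} (b : BetaStrategy X) (r : ℕ → Move X → P → Move X)
    (hr : ∀ n V ε, r n V ε ≤ V) (d : ℕ → P) : AlphaStrategy X where
  move
    | 0, s => b.move 0 s
    | n + 1, s => r n (s (Fin.last n)) (d (n / 2))
  legal k s := hr (2 * k) (s (Fin.last (2 * k))) (d (2 * k / 2))

variable {P : Type*} {b : BetaStrategy X} {r : ℕ → Move X → P → Move X}
  {hr : ∀ n V ε, r n V ε ≤ V}

theorem play_followSeq (d : ℕ → P) (k : ℕ) : play (followSeq b r hr d) b (2 * k + 1) =
    r (2 * k) (play (followSeq b r hr d) b (2 * k)) (d k) := by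
  rw [play_of_odd _ _ (by lia)]
  change r (2 * k) _ (d (2 * k / 2)) = _
  rw [show 2 * k / 2 = k by lia]
  rfl

theorem play_followSeq_congr {d d' : ℕ → P} {m : ℕ} (h : ∀ i < m, d i = d' i) (n : ℕ)
    (hn : n ≤ 2 * m) : play (followSeq b r hr d) b n = play (followSeq b r hr d') b n := by
  induction n using Nat.strong_induction_on with
  | _ n ih =>
    rcases Nat.even_or_odd' n with ⟨k, rfl | rfl⟩
    · rw [play_of_even _ _ (by lia), play_of_even _ _ (by lia)]
      congr 1
      funext i
      exact ih i i.2 (i.2.le.trans hn)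
    · rw [play_followSeq, play_followSeq, ih _ (by lia) (by lia), h k (by lia)]

end TandemGame

/-! ### The Baire properties of E and its powers -/

namespace SpaceE

variable {A : (ℕ → Fin 3) → Set CPlus}

theorem exists_ne_ne (i j : Fin 3) : ∃ k : Fin 3, k ≠ i ∧ k ≠ j := by
  decide +revert

theorem isTauBaire (hA : IsDisjointStationaryFamily A) : IsTauBaire (SpaceE A) := by
  intro b
  choose pt len hle hlen hord using exists_cylinderMove_le hA.stationary
  let a (d : ℕ → CPlus) : AlphaStrategy (SpaceE A) :=
    followSeq b (fun n V ε ↦ cylinderMove (pt n V ε) (len n V ε)) hle d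
  let q (d : ℕ → CPlus) (k : ℕ) : SpaceE A := pt (2 * k) (play (a d) b (2 * k)) (d k)
  let l (d : ℕ → CPlus) (k : ℕ) : ℕ := len (2 * k) (play (a d) b (2 * k)) (d k)
  have hplay : ∀ d k, play (a d) b (2 * k + 1) = cylinderMove (q d k) (l d k) :=
    fun d k ↦ play_followSeq d k
  have hl : ∀ d k, 2 * k ≤ l d k := fun d k ↦ hlen _ _ _
  have hcongr : ∀ k d d', (∀ i < k + 1, d i = d' i) → q d k = q d' k := by
    intro k d d' h
    have : play (a d) b (2 * k) = play (a d') b (2 * k) :=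
      play_followSeq_congr h (2 * k) (by lia)
    simp only [q, this, h k (Nat.lt_succ_self k)]
  have hnest : ∀ d i k n, q d (2 * (k + n) + i) ∈ cylinder (q d (2 * k + i)) (l d (2 * k + i)) := by
    intro d i k n
    suffices h : play (a d) b (2 * (2 * (k + n) + i) + 1) ≤ play (a d) b (2 * (2 * k + i) + 1) by
      rw [hplay, hplay] at h
      exact h (self_mem_cylinder _ _)
    induction n with
    | zero => exact le_rfl
    | succ n ih =>
      refine ((play_alpha_le _ _ _).trans ?_).trans ih
      have := play_beta_le (a d) b (2 * (k + n) + i)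
      rwa [show 2 * (2 * (k + n) + i) + 4 = 2 * (2 * (k + (n + 1)) + i) by lia] at this
  -- Answers of α' with index of parity i belong to board i. Answer 2(j + 1) + i fixes more than j
  -- coordinates, so it already shows coordinate j of the limit.
  let X (d : ℕ → CPlus) (i j : ℕ) : Fin 3 := (q d (2 * (j + 1) + i)).1.1 j
  let F (d : ℕ → CPlus) (i j : ℕ) : CPlus := (q d (2 * (j + 1) + i)).1.2 j
  have hlim : ∀ d i k, ∀ j < l d (2 * k + i),
      X d i j = (q d (2 * k + i)).1.1 j ∧ F d i j = (q d (2 * k + i)).1.2 j := by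
    intro d i k j hj
    have h₁ := hnest d i k (j + 1) j hj
    have h₂ := hnest d i (j + 1) k j (by have := hl d (2 * (j + 1) + i); lia)
    rw [add_comm (j + 1) k] at h₂
    exact ⟨h₂.1.symm.trans h₁.1, h₂.2.symm.trans h₁.2⟩
  obtain ⟨r, C, hC, hbranch⟩ := CPlus.exists_fibre_club
    (R := (ℕ → Fin 3) × (ℕ → Fin 3)) (ι := ℕ × ℕ)
    (by rw [mk_prod, lift_id, CPlus.mk_branches, continuum_mul_self])
    (fun d ↦ (X d 0, X d 1))
    -- The fibres are closed because each coordinate of the branches depends on finitely many terms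
    -- of d.
    (by
      intro d r h
      have : ∀ i j, ∃ d', X d i j = X d' i j ∧ (X d' 0, X d' 1) = r := fun i j ↦ by
        obtain ⟨d', hd', hr⟩ := h (2 * (j + 1) + i + 1)
        exact ⟨d', by simp only [X, hcongr _ d d' fun i hi ↦ (hd' i hi).symm], hr⟩
      ext j
      · obtain ⟨d', hd', hr⟩ := this 0 j
        simp only [hd', ← hr]
      · obtain ⟨d', hd', hr⟩ := this 1 j
        simp only [hd', ← hr])
    (fun d ij ↦ F d ij.1 ij.2)
    (fun ij ↦ ⟨2 * (ij.2 + 1) + ij.1 + 1, fun d d' h ↦ by simp only [F, hcongr _ d d' h]⟩)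
  choose y hy using fun n ↦ exists_ne_ne (r.1 n) (r.2 n)
  obtain ⟨γ, hγA, hγC⟩ := hA.stationary y hC
  obtain ⟨d, rfl, hF, hd⟩ := hbranch γ hγC (hA.subset y hγA)
  have hlub : ∀ i < 2, IsLUB (range (F d i)) γ := by
    intro i hi
    refine ⟨by rintro _ ⟨j, rfl⟩; exact (hF (i, j)).le, fun u hu ↦ not_lt.1 fun huγ ↦ ?_⟩
    obtain ⟨k, hk⟩ := hd u huγ i hi
    obtain ⟨j, hj, hlt⟩ := hord (2 * (2 * k + i)) (play (a d) b (2 * (2 * k + i))) (d (2 * k + i))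
    have := hu ⟨j, rfl⟩
    rw [(hlim d i k j hj).2] at this
    exact (hk.trans_lt hlt).not_ge this
  have hmem : ∀ (p : SpaceE A) (i : ℕ), p.1 = (X d i, F d i) →
      ∀ k, p ∈ (play (a d) b (4 * k + 2 * i)).1 := by
    intro p i hp k
    rw [show 4 * k + 2 * i = 2 * (2 * k + i) by lia]
    refine play_alpha_le (a d) b _ ?_
    rw [hplay]
    intro j hj
    rw [hp]
    exact hlim d i k j hj
  refine ⟨a d, ⟨⟨(X d 0, F d 0), γ, ⟨y, fun n ↦ (hy n).1, hγA⟩, hlub 0 (by lia)⟩, ?_⟩,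
    ⟨⟨(X d 1, F d 1), γ, ⟨y, fun n ↦ (hy n).2, hγA⟩, hlub 1 (by lia)⟩, ?_⟩⟩
  · exact mem_iInter.2 fun k ↦ hmem _ 0 rfl k
  · exact mem_iInter.2 fun k ↦ hmem _ 1 rfl k

theorem dense_exists_ordinal_ge (hA : ∀ y, IsStationary (A y)) (ε : CPlus) :
    Dense {p : SpaceE A | ∃ m, ε ≤ p.1.2 m} := fun _ ↦
  mem_closure_iff_nhds.2 fun _ hU ↦
    (exists_mem_ordinal_gt hA hU ε).imp fun _ h ↦ ⟨h.1, h.2.imp fun _ ↦ le_of_lt⟩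

theorem isOpen_exists_ordinal_le {Y : Type*} [TopologicalSpace Y] {u v : Y → SpaceE A}
    (hu : Continuous u) (hv : Continuous v) (n : ℕ) :
    IsOpen {z | ∃ m, (u z).1.2 n ≤ (v z).1.2 m} := by
  simp only [ofPred_exists]
  refine isOpen_iUnion fun m ↦ ?_
  have h := ((continuous_ordinal n).comp hu).prodMk ((continuous_ordinal m).comp hv)
  exact (isOpen_discrete {w : CPlus × CPlus | w.1 ≤ w.2}).preimage h

theorem isLUB_of_forall_exists_le {f g : ℕ → CPlus} (hfg : ∀ n, ∃ m, f n ≤ g m)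
    {γ γ' : CPlus} (hf : IsLUB (range f) γ) (hg : IsLUB (range g) γ') : γ ≤ γ' := by
  refine hf.2 ?_
  rintro _ ⟨n, rfl⟩
  obtain ⟨m, hm⟩ := hfg n
  exact hm.trans (hg.1 ⟨m, rfl⟩)

/-- The dense open conditions bound the three suprema by one another cyclically, so they coincide on
a dense set. -/
theorem not_baireSpace_cube (hA : IsDisjointStationaryFamily A) :
    ¬ BaireSpace (SpaceE A × SpaceE A × SpaceE A) := by
  intro _
  let D₁ (n : ℕ) : Set (SpaceE A × SpaceE A × SpaceE A) := {z | ∃ m, z.1.1.2 n ≤ z.2.1.1.2 m}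
  let D₂ (n : ℕ) : Set (SpaceE A × SpaceE A × SpaceE A) := {z | ∃ m, z.2.1.1.2 n ≤ z.2.2.1.2 m}
  let D₃ (n : ℕ) : Set (SpaceE A × SpaceE A × SpaceE A) := {z | ∃ m, z.2.2.1.2 n ≤ z.1.1.2 m}
  have ho₁ : ∀ n, IsOpen (D₁ n) := isOpen_exists_ordinal_le (by fun_prop) (by fun_prop)
  have ho₂ : ∀ n, IsOpen (D₂ n) := isOpen_exists_ordinal_le (by fun_prop) (by fun_prop)
  have ho₃ : ∀ n, IsOpen (D₃ n) := isOpen_exists_ordinal_le (by fun_prop) (by fun_prop)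
  have hd₁ : ∀ n, Dense (D₁ n) := fun n ⟨p, q, r⟩ ↦
    map_mem_closure (f := fun q' ↦ (p, q', r)) (by fun_prop)
      (dense_exists_ordinal_ge hA.stationary (p.1.2 n) q) fun _ h ↦ h
  have hd₂ : ∀ n, Dense (D₂ n) := fun n ⟨p, q, r⟩ ↦
    map_mem_closure (f := fun r' ↦ (p, q, r')) (by fun_prop)
      (dense_exists_ordinal_ge hA.stationary (q.1.2 n) r) fun _ h ↦ h
  have hd₃ : ∀ n, Dense (D₃ n) := fun n ⟨p, q, r⟩ ↦
    map_mem_closure (f := fun p' ↦ (p', q, r)) (by fun_prop)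
      (dense_exists_ordinal_ge hA.stationary (r.1.2 n) p) fun _ h ↦ h
  have hdense : Dense (⋂ n, D₁ n ∩ (D₂ n ∩ D₃ n)) :=
    dense_iInter_of_isOpen (fun n ↦ (ho₁ n).inter ((ho₂ n).inter (ho₃ n))) fun n ↦
      (hd₁ n).inter_of_isOpen_left ((hd₂ n).inter_of_isOpen_left (hd₃ n) (ho₂ n)) (ho₁ n)
  obtain ⟨o⟩ : Nonempty CPlus := inferInstance
  choose p hp using fun i : Fin 3 ↦
    exists_extension hA.stationary (fun _ ↦ i) (fun _ ↦ o) 0 o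
  have hopen : ∀ i, IsOpen {q : SpaceE A | q.1.1 0 = i} := fun i ↦
    (isOpen_discrete {i}).preimage (continuous_branch 0)
  obtain ⟨⟨q₀, q₁, q₂⟩, ⟨h₀, h₁, h₂⟩, hD⟩ := hdense.inter_open_nonempty _
    ((hopen 0).prod ((hopen 1).prod (hopen 2)))
    ⟨(p 0, p 1, p 2), congrFun (hp 0).1 0, congrFun (hp 1).1 0, congrFun (hp 2).1 0⟩
  rw [mem_iInter] at hD
  obtain ⟨γ₀, ⟨y₀, hy₀, hγ₀⟩, hs₀⟩ := q₀.2
  obtain ⟨γ₁, ⟨y₁, hy₁, hγ₁⟩, hs₁⟩ := q₁.2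
  obtain ⟨γ₂, ⟨y₂, hy₂, hγ₂⟩, hs₂⟩ := q₂.2
  have h01 := isLUB_of_forall_exists_le (fun n ↦ (hD n).1) hs₀ hs₁
  have h12 := isLUB_of_forall_exists_le (fun n ↦ (hD n).2.1) hs₁ hs₂
  have h20 := isLUB_of_forall_exists_le (fun n ↦ (hD n).2.2) hs₂ hs₀
  obtain rfl : γ₀ = γ₁ := h01.antisymm (h12.trans h20)
  obtain rfl : γ₀ = γ₂ := (h01.trans h12).antisymm h20
  have heq : ∀ {y z}, γ₀ ∈ A y → γ₀ ∈ A z → y = z := fun {y z} hy hz ↦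
    by_contra fun hne ↦ Set.disjoint_left.1 (hA.disjoint y z hne) hy hz
  obtain rfl := heq hγ₀ hγ₁
  obtain rfl := heq hγ₀ hγ₂
  have e₀ := hy₀ 0
  have e₁ := hy₁ 0
  have e₂ := hy₂ 0
  simp only [mem_ofPred_eq] at h₀ h₁ h₂
  rw [h₀] at e₀
  rw [h₁] at e₁
  rw [h₂] at e₂
  generalize y₀ 0 = i at e₀ e₁ e₂
  fin_cases i <;> simp_all

theorem metrizableSpace_seq (α : Type*) [TopologicalSpace α] [TopologicalSpace.MetrizableSpace α] :
    TopologicalSpace.MetrizableSpace (ℕ → α) := by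
  let := TopologicalSpace.metrizableSpaceMetric α
  exact UniformSpace.metrizableSpace

theorem metrizableSpace (A : (ℕ → Fin 3) → Set CPlus) :
    TopologicalSpace.MetrizableSpace (SpaceE A) :=
  have := metrizableSpace_seq (Fin 3)
  have := metrizableSpace_seq CPlus
  Topology.IsEmbedding.subtypeVal.metrizableSpace

theorem not_isTauBaire_square (hA : IsDisjointStationaryFamily A) :
    ¬ IsTauBaire (SpaceE A × SpaceE A) := by
  intro h
  have := h.baireSpace_prod
  obtain ⟨o⟩ : Nonempty CPlus := inferInstance
  have : Nonempty (SpaceE A) :=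
    ⟨(exists_extension hA.stationary (fun _ ↦ 0) (fun _ ↦ o) 0 o).choose⟩
  -- Forgetting one of the four factors is an open continuous surjection, which transfers the Baire
  -- property to the cube.
  have hq : IsOpenQuotientMap
      (Prod.map Prod.fst id : (SpaceE A × SpaceE A) × SpaceE A × SpaceE A → _) :=
    ⟨Prod.fst_surjective.prodMap Function.surjective_id, by fun_prop,
      isOpenMap_fst.prodMap .id⟩
  exact not_baireSpace_cube hA hq.baireSpace

end SpaceE

theorem proposition9p1 :
    (∃ A : (ℕ → Fin 3) → Set CPlus, IsDisjointStationaryFamily A) ∧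
    ∀ A : (ℕ → Fin 3) → Set CPlus, IsDisjointStationaryFamily A →
      TopologicalSpace.MetrizableSpace (SpaceE A) ∧
      IsTauBaire (SpaceE A) ∧
      BaireSpace (SpaceE A × SpaceE A) ∧
      ¬ BaireSpace (SpaceE A × SpaceE A × SpaceE A) ∧
      ¬ IsTauBaire (SpaceE A × SpaceE A) :=
  ⟨CPlus.exists_isDisjointStationaryFamily, fun A hA ↦
    ⟨SpaceE.metrizableSpace A, SpaceE.isTauBaire hA, (SpaceE.isTauBaire hA).baireSpace_prod,
      SpaceE.not_baireSpace_cube hA, SpaceE.not_isTauBaire_square hA⟩⟩
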